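/- Let $r\ge 0$ be an integer and let $\mathcal S_r=\{\pm1\}^{r+1}$. Regard a word over the alphabet $\mathcal S_r$ as a walk in $\mathbb Z^{r+1}$ that starts at the origin and whose steps are the letters of the word. Let $\mathbf A^{(r)}$ be the language of all walks that end with $x_{r+1}=0$, and let $\mathbf D^{(r)}$ be the language of all walks that end with $x_{r+1}=0$ and satisfy $x_{r+1}\ge 0$ at all times. Let $\mathbf B^{(r)}\subseteq\mathbf A^{(r)}$ and $\mathbf E^{(r)}\subseteq\mathbf D^{(r)}$ be the sublanguages of walks that avoid backtracking (no step $v$ is directly followed by $-v$), and let $\mathbf C^{(r)}\subseteq\mathbf A^{(r)}$ and $\mathbf F^{(r)}\subseteq\mathbf D^{(r)}$ be the sublanguages of walks that avoid consecutive repeats (no step $v$ is directly followed by $v$). All walks in these languages have even length. For a language $\mathbf L$ among these six, let $\ell_n$ be the number of walks in $\mathbf L$ with $2n$ steps and let $G(x;\mathbf L)=\sum_{n\ge 0}\ell_n x^n\in\mathbb Q[[x]]$. **Theorem.** Let $\mathbf L\in\{\mathbf A^{(r)},\mathbf B^{(r)},\mathbf C^{(r)},\mathbf D^{(r)},\mathbf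 E^{(r)},\mathbf F^{(r)}\}$. Then $\mathbf L$ is a deterministic context-free language, i.e. it is recognized by a deterministic pushdown automaton (accepting by final state). Moreover, $G(x;\mathbf L)$ is algebraic, i.e. it is a root of a nonzero polynomial with coefficients in $\mathbb Q[x]$, and the sequence $(\ell_n)_{n\ge0}$ is holonomic: there are $j\ge 0$ and polynomials $p_0,\dots,p_j\in\mathbb Q[x]$, not all zero, such that $p_j(n)\ell_{n+j}+\cdots+p_1(n)\ell_{n+1}+p_0(n)\ell_n=0$ for all $n\ge 0$. -/

import Mathlib

/-- A pushdown automaton over the input alphabet `α` with state set `Q` and stack alphabet `Γ`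
that is deterministic. The top of a stack is the head of the list; in state `q` with top symbol
`Z`, the transition `step q (some a) Z = some (q', γ)` reads `a`, moves to `q'` and replaces `Z`
by `γ`, and `step q none Z = some (q', γ)` does so without reading (an ε-move). -/
structure DPDA (α Q Γ : Type*) where
  start : Q
  bottom : Γ
  accept : Set Q
  step : Q → Option α → Γ → Option (Q × List Γ)
  deterministic : ∀ q Z, step q none Z ≠ none → ∀ a, step q (some a) Z = none

/-- One move between configurations (state, unread input, stack). -/
inductive DPDA.Move {α Q Γ : Type*} (M : DPDA α Q Γ) :
    Q × List α × List Γ → Q × List α × List Γ → Prop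
  | read {q : Q} {a : α} {w : List α} {Z : Γ} {s : List Γ} {q' : Q} {γ : List Γ}
      (h : M.step q (some a) Z = some (q', γ)) :
      DPDA.Move M (q, a :: w, Z :: s) (q', w, γ ++ s)
  | eps {q : Q} {w : List α} {Z : Γ} {s : List Γ} {q' : Q} {γ : List Γ}
      (h : M.step q none Z = some (q', γ)) :
      DPDA.Move M (q, w, Z :: s) (q', w, γ ++ s)

/-- The language recognized by a DPDA (acceptance by final state once the input is consumed). -/
def DPDA.language {α Q Γ : Type*} (M : DPDA α Q Γ) : Language α :=
  {w : List α | ∃ q ∈ M.accept, ∃ s : List Γ,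
    Relation.ReflTransGen M.Move (M.start, w, [M.bottom]) (q, [], s)}

/-- A language is deterministic context-free if it is recognized by a DPDA with finitely many
states and stack symbols. -/
def IsDeterministicContextFree {α : Type} (L : Language α) : Prop :=
  ∃ (Q Γ : Type) (_ : Finite Q) (_ : Finite Γ) (M : DPDA α Q Γ), M.language = L

/-- The step set `{±1}^(r+1)`. -/
abbrev WalkStep (r : ℕ) : Type := Fin (r + 1) → ℤˣ

/-- The point of `ℤ^(r+1)` reached from the origin after the steps of `w`. -/
def walkEnd {r : ℕ} (w : List (WalkStep r)) : Fin (r + 1) → ℤ :=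
  (w.map fun v i => (v i : ℤ)).sum

/-- Walks that end with last coordinate `0`. -/
def walkA (r : ℕ) : Language (WalkStep r) :=
  {w : List (WalkStep r) | walkEnd w (Fin.last r) = 0}

/-- Walks that end with last coordinate `0` and whose last coordinate is never negative. -/
def walkD (r : ℕ) : Language (WalkStep r) :=
  {w : List (WalkStep r) | walkEnd w (Fin.last r) = 0 ∧
    ∀ u : List (WalkStep r), u <+: w → 0 ≤ walkEnd u (Fin.last r)}

/-- Walks avoiding backtracking, i.e. the contiguous pattern `[v, -v]`. -/
def walkX (r : ℕ) : Language (WalkStep r) :=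
  {w : List (WalkStep r) | ∀ v : WalkStep r, ¬ [v, -v] <:+: w}

/-- Walks avoiding consecutive repeats, i.e. the contiguous pattern `[v, v]`. -/
def walkY (r : ℕ) : Language (WalkStep r) :=
  {w : List (WalkStep r) | ∀ v : WalkStep r, ¬ [v, v] <:+: w}

def walkB (r : ℕ) : Language (WalkStep r) := walkA r ⊓ walkX r

def walkC (r : ℕ) : Language (WalkStep r) := walkA r ⊓ walkY r

def walkE (r : ℕ) : Language (WalkStep r) := walkD r ⊓ walkX r

def walkF (r : ℕ) : Language (WalkStep r) := walkD r ⊓ walkY r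

/-- The number of walks with `2 n` steps in `L` (a finite set, since the alphabet is finite). -/
noncomputable def walkCount {r : ℕ} (L : Language (WalkStep r)) (n : ℕ) : ℕ :=
  {w : List (WalkStep r) | w ∈ L ∧ w.length = 2 * n}.ncard

/-- The generating function `G(x; L) = ∑ₙ |L ∩ S^(2n)| xⁿ`. -/
noncomputable def walkGenFun {r : ℕ} (L : Language (WalkStep r)) : PowerSeries ℚ :=
  PowerSeries.mk fun n => (walkCount L n : ℚ)

/-- A sequence is holonomic if `p_j(n) t_{n+j} + ⋯ + p_0(n) t_n = 0` for all `n`, for some `j` and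
polynomials `p_0, …, p_j` not all of which are zero. -/
def IsHolonomic (t : ℕ → ℚ) : Prop :=
  ∃ (j : ℕ) (p : Fin (j + 1) → Polynomial ℚ), (∃ i, p i ≠ 0) ∧
    ∀ n : ℕ, ∑ i : Fin (j + 1), (p i).eval (n : ℚ) * t (n + i) = 0

/-! Each of the six languages is a `walkLang R d`: a relation `R` on consecutive steps, and a
proposition `d` that switches the nonnegativity constraint on. A one-counter machine recognizes it,
with the previous step and the sign of the height in the finite control and the absolute height in
unary on the stack (`walkDPDA_move_iff`).

For the counting, the number of letters with a given last coordinate allowed after `v` is `a` if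
that coordinate repeats the one of `v`, and `b` otherwise. So walks collapse to weighted ±1 paths
(`card_completions_some`). Removing one step gives a linear system indexed by the height, solved by
geometric sequences `α μ^k`, `β μ^k` with `μ` a root of a quadratic over ℚ[x]
(`exists_excursion_series`). Hence `d G = p + q S` with polynomial `d ≠ 0`, `p`, `q` and `S² = Δ`
(`exists_quadratic_form`). Squaring gives an algebraic equation; differentiating gives a first-order
linear ODE, whose coefficients form the recurrence. -/

/-! ### Algebraicity and holonomy in a quadratic extension of ℚ[x] -/

section QuadraticPowerSeries

open PowerSeries

theorem coeff_coe_mul_mk (P : Polynomial ℚ) (f : ℕ → ℚ) {D : ℕ} (hD : P.natDegree ≤ D) (n : ℕ) :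
    coeff (n + D) ((P : ℚ⟦X⟧) * mk f) =
      ∑ i : Fin (D + 1), P.coeff (D - i) * f (n + i) := by
  rw [coeff_mul, Finset.Nat.sum_antidiagonal_eq_sum_range_succ
    (fun i j => coeff i (P : ℚ⟦X⟧) * coeff j (mk f)),
    ← Finset.sum_range (fun i => P.coeff (D - i) * f (n + i)),
    ← Finset.sum_range_reflect (fun i => P.coeff (D - i) * f (n + i))]
  symm
  calc ∑ j ∈ Finset.range (D + 1), P.coeff (D - (D + 1 - 1 - j)) * f (n + (D + 1 - 1 - j))
      = ∑ j ∈ Finset.range (D + 1), coeff j (P : ℚ⟦X⟧) * coeff (n + D - j) (mk f) := by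
        refine Finset.sum_congr rfl fun j hj => ?_
        have hj' : j ≤ D := Nat.lt_succ_iff.mp (Finset.mem_range.mp hj)
        rw [Polynomial.coeff_coe, coeff_mk]
        congr 2 <;> omega
    _ = _ := by
        refine Finset.sum_subset (Finset.range_subset_range.mpr (by omega)) fun j _ hj => ?_
        have : D < j := by simpa using hj
        rw [Polynomial.coeff_coe, Polynomial.coeff_eq_zero_of_natDegree_lt (by omega), zero_mul]

/-- A power series satisfying a first-order linear differential equation with polynomial
coefficients, written with the Euler operator, has a holonomic coefficient sequence. -/
theorem IsHolonomic.of_euler_equation {g : ℕ → ℚ} {P Q R : Polynomial ℚ} (h : P ≠ 0 ∨ Q ≠ 0)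
    (hode : (P : ℚ⟦X⟧) * mk (fun n => (n : ℚ) * g n) + (Q : ℚ⟦X⟧) * mk g = (R : ℚ⟦X⟧)) :
    IsHolonomic g := by
  -- `D` exceeds the degree of `R`, so the coefficient of degree `n + D` gives a homogeneous
  -- recurrence already from `n = 0`.
  set D := P.natDegree + Q.natDegree + R.natDegree + 1 with hDdef
  refine ⟨D, fun i => Polynomial.C (P.coeff (D - i)) * (Polynomial.X + Polynomial.C ((i : ℕ) : ℚ))
    + Polynomial.C (Q.coeff (D - i)), ?_, fun n => ?_⟩
  · have key : ∃ i, i ≤ D ∧ (P.coeff i ≠ 0 ∨ Q.coeff i ≠ 0) := by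
      rcases h with h | h
      · exact ⟨P.natDegree, by omega, Or.inl (by simpa using h)⟩
      · exact ⟨Q.natDegree, by omega, Or.inr (by simpa using h)⟩
    obtain ⟨i, hi, hne⟩ := key
    refine ⟨⟨D - i, by omega⟩, fun h0 => ?_⟩
    have hDi : D - (D - i) = i := by omega
    simp only [hDi] at h0
    have h1 := congrArg (Polynomial.coeff · 1) h0
    simp [mul_add, Polynomial.coeff_C] at h1
    have h2 := congrArg (Polynomial.coeff · 0) h0
    simp [mul_add, h1] at h2
    tauto
  · have hc := congrArg (coeff (n + D)) hode
    rw [map_add, coeff_coe_mul_mk P _ (by omega), coeff_coe_mul_mk Q _ (by omega),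
      Polynomial.coeff_coe, Polynomial.coeff_eq_zero_of_natDegree_lt (by omega),
      ← Finset.sum_add_distrib] at hc
    rw [← hc]
    refine Finset.sum_congr rfl fun i _ => ?_
    simp
    ring

theorem X_mul_derivative_mk (g : ℕ → ℚ) :
    (X : ℚ⟦X⟧) * derivative ℚ (mk g) = mk fun n => (n : ℚ) * g n := by
  ext n
  cases n with
  | zero => simp
  | succ n => simp [coeff_succ_X_mul, coeff_derivative, mul_comm]

theorem coe_ofNat_two : ((2 : Polynomial ℚ) : ℚ⟦X⟧) = 2 :=
  map_ofNat (Polynomial.coeToPowerSeries.ringHom (R := ℚ)) 2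

variable {S G : ℚ⟦X⟧} {Δ d p q : Polynomial ℚ}

/-- Expand `(d G - p)² = q² Δ`. -/
theorem isAlgebraic_of_quadratic (hS : S ^ 2 = Δ) (hd : d ≠ 0)
    (hG : (d : ℚ⟦X⟧) * G = p + q * S) : IsAlgebraic (Polynomial ℚ) G := by
  refine ⟨Polynomial.C (d ^ 2) * Polynomial.X ^ 2 + Polynomial.C (-2 * d * p) * Polynomial.X +
    Polynomial.C (p ^ 2 - q ^ 2 * Δ), fun h0 => ?_, ?_⟩
  · have h1 := congrArg (Polynomial.coeff · 2) h0
    simp [-map_pow, -map_mul, -map_neg, -map_sub, hd] at h1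
  · have hmap : ∀ s : Polynomial ℚ, algebraMap (Polynomial ℚ) ℚ⟦X⟧ s = (s : ℚ⟦X⟧) := fun s => by
      simp [algebraMap_apply']
    simp only [map_add, map_mul, map_pow, Polynomial.aeval_X, Polynomial.aeval_C, hmap]
    push_cast
    rw [coe_ofNat_two]
    linear_combination ((d : ℚ⟦X⟧) * G - p + q * S) * hG + (q : ℚ⟦X⟧) ^ 2 * hS

/-- Since `2 S S' = Δ'`, one has `2 Δ S' = Δ' S`. Differentiating `d G = p + q S`, multiplying by `2
Δ q` and replacing `q S` by `d G - p` eliminates `S`. -/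
theorem isHolonomic_of_quadratic {g : ℕ → ℚ} (hS : S ^ 2 = Δ) (hΔ : Δ ≠ 0) (hd : d ≠ 0)
    (hG : (d : ℚ⟦X⟧) * mk g = p + q * S) : IsHolonomic g := by
  -- The leading coefficient `2 Δ q d` vanishes here, but `d G = p` is already an equation of order
  -- zero.
  by_cases hq : q = 0
  · refine IsHolonomic.of_euler_equation (P := 0) (Q := d) (R := p) (Or.inr hd) ?_
    rw [hG, hq]
    simp
  refine IsHolonomic.of_euler_equation (P := 2 * Δ * q * d)
    (Q := Polynomial.X * (2 * Δ * q * Polynomial.derivative d -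
      (2 * Δ * Polynomial.derivative q + q * Polynomial.derivative Δ) * d))
    (R := Polynomial.X * (2 * Δ * q * Polynomial.derivative p -
      (2 * Δ * Polynomial.derivative q + q * Polynomial.derivative Δ) * p))
    (Or.inl (by simp [hΔ, hq, hd])) ?_
  have hS' := congrArg (derivative ℚ) hS
  have hG' := congrArg (derivative ℚ) hG
  simp only [Derivation.leibniz, Derivation.leibniz_pow, map_add, derivative_coe, smul_eq_mul]
    at hS' hG'
  rw [← X_mul_derivative_mk]
  simp only [nsmul_eq_mul, Nat.cast_ofNat, Nat.add_one_sub_one, pow_one] at hS'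
  push_cast
  rw [coe_ofNat_two]
  linear_combination 2 * X * (Δ : ℚ⟦X⟧) * q * hG' + X * (q : ℚ⟦X⟧) ^ 2 * S * hS'
    - X * (2 * (Δ : ℚ⟦X⟧) * Polynomial.derivative q + q * Polynomial.derivative Δ) * hG
    - 2 * X * (q : ℚ⟦X⟧) ^ 2 * derivative ℚ S * hS

/-- The coefficients of the power series solution of `μ = a + x (a μ² + c μ)`. -/
def slopeCoeff (a c : ℚ) : ℕ → ℚ
  | 0 => a
  | n + 1 => a * ∑ i : Fin (n + 1), slopeCoeff a c i * slopeCoeff a c (n - i) + c * slopeCoeff a c n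

theorem exists_slope (a c : ℚ) : ∃ μ : ℚ⟦X⟧, μ = C a + X * (C a * μ ^ 2 + C c * μ) := by
  refine ⟨mk (slopeCoeff a c), ?_⟩
  ext n
  cases n with
  | zero => simp [slopeCoeff]
  | succ n =>
    rw [map_add, coeff_succ_X_mul, map_add, coeff_C_mul, coeff_C_mul, sq, coeff_mul,
      Finset.Nat.sum_antidiagonal_eq_sum_range_succ
        (fun i j => coeff i (mk (slopeCoeff a c)) * coeff j (mk (slopeCoeff a c))),
      Finset.sum_range]
    simp [slopeCoeff]

/-- The series counting excursions generates, up to an affine change, a quadratic extension. -/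
theorem exists_quadratic_form (a b e K : ℚ) {μ α : ℚ⟦X⟧}
    (hμ : μ = C a + X * (C a * μ ^ 2 + C (b ^ 2 - a ^ 2) * μ))
    (hα : α * (1 - X * C a * μ - X * C b * C e) = C b) :
    ∃ (S : ℚ⟦X⟧) (Δ d p q : Polynomial ℚ), S ^ 2 = Δ ∧ Δ ≠ 0 ∧ d ≠ 0 ∧
      (d : ℚ⟦X⟧) * (1 + X * C K * α) = (p : ℚ⟦X⟧) + (q : ℚ⟦X⟧) * S := by
  -- With `c = b² - a²`, `Δ` is the discriminant of `a X μ² + (c X - 1) μ + a`, and `S` is its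
  -- square root. `T` is chosen so that `α (T + S) = 2 b`.
  set Δ : Polynomial ℚ := (1 - Polynomial.C (b ^ 2 - a ^ 2) * Polynomial.X) ^ 2
    - Polynomial.C (4 * a ^ 2) * Polynomial.X with hΔ
  set T : Polynomial ℚ := 1 + Polynomial.C (b ^ 2 - a ^ 2 - 2 * b * e) * Polynomial.X with hT
  set S : ℚ⟦X⟧ := 1 - C (b ^ 2 - a ^ 2) * X - 2 * C a * X * μ with hSdef
  have hS : S ^ 2 = Δ := by
    rw [hSdef, hΔ]
    push_cast
    simp only [map_sub, map_mul, map_pow, map_ofNat] at hμ ⊢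
    linear_combination (-4 * C a * X) * hμ
  have hΔ0 : Δ ≠ 0 := fun h => by
    have := congrArg (Polynomial.eval 0) h
    simp [hΔ] at this
  have hT0 : T ≠ 0 := fun h => by
    have := congrArg (Polynomial.eval 0) h
    simp [hT] at this
  have hTS : α * (T + S) = 2 * C b := by
    rw [hSdef, hT]
    push_cast
    simp only [map_sub, map_mul, map_pow, map_ofNat] at hα ⊢
    linear_combination 2 * hα
  have hTS0 : (T : ℚ⟦X⟧) + S ≠ 0 := fun h => by
    have := congrArg constantCoeff h
    rw [hSdef, hT] at this
    push_cast at this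
    simp at this
  -- Multiplying by `T - S` rationalizes the denominator unless `T² = Δ`. In that case, which occurs
  -- for instance if `a = 0` and `e = b`, `S = T` and `α = b / T` is rational.
  by_cases hdeg : T ^ 2 - Δ = 0
  · have hST : S = T := by
      have h1 : ((T : ℚ⟦X⟧) - S) * (T + S) = 0 := by
        have := congrArg (Polynomial.toPowerSeries) hdeg
        push_cast at this
        linear_combination this - hS
      exact (sub_eq_zero.mp ((mul_eq_zero.mp h1).resolve_right hTS0)).symm
    refine ⟨S, Δ, T, T + Polynomial.X * Polynomial.C (K * b), 0, hS, hΔ0, hT0, ?_⟩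
    push_cast
    rw [hST] at hTS
    have : (T : ℚ⟦X⟧) * α = C b := by
      have h2 : (2 : ℚ⟦X⟧) ≠ 0 := fun h => by
        have := congrArg constantCoeff h
        rw [map_ofNat] at this
        norm_num at this
      apply mul_left_cancel₀ h2
      linear_combination hTS
    rw [map_mul]
    linear_combination X * C K * this
  · refine ⟨S, Δ, T ^ 2 - Δ, T ^ 2 - Δ + Polynomial.X * Polynomial.C (2 * K * b) * T,
      - Polynomial.X * Polynomial.C (2 * K * b), hS, hΔ0, hdeg, ?_⟩
    push_cast
    simp only [map_mul, map_ofNat]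
    linear_combination X * C K * ((T : ℚ⟦X⟧) - S) * hTS + X * C K * α * hS

end QuadraticPowerSeries

/-! ### A letter-by-letter description of the languages -/

section WalkLanguages

variable {r : ℕ}

/-- The walks whose consecutive steps are related by `R`, which end with last coordinate `0` and,
if `d` holds, never have negative last coordinate. -/
def walkLang (R : WalkStep r → WalkStep r → Prop) (d : Prop) : Language (WalkStep r) :=
  {w : List (WalkStep r) | w.IsChain R ∧ walkEnd w (Fin.last r) = 0 ∧
    (d → ∀ u : List (WalkStep r), u <+: w → 0 ≤ walkEnd u (Fin.last r))}

/-- The words that complete a walk at height `h` whose previous step is `p` to a walk of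
`walkLang R d`. -/
def Completes (R : WalkStep r → WalkStep r → Prop) (d : Prop) :
    Option (WalkStep r) → ℤ → List (WalkStep r) → Prop
  | _, h, [] => h = 0
  | p, h, v :: w => (∀ u ∈ p, R u v) ∧ (d → 0 ≤ h + v (Fin.last r)) ∧
      Completes R d (some v) (h + v (Fin.last r)) w

theorem walkEnd_nil (i : Fin (r + 1)) : walkEnd ([] : List (WalkStep r)) i = 0 := rfl

theorem walkEnd_cons (v : WalkStep r) (w : List (WalkStep r)) (i : Fin (r + 1)) :
    walkEnd (v :: w) i = v i + walkEnd w i := by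
  simp [walkEnd]

/-- Removing the first letter shifts the heights of the remaining prefixes by a constant. The
hypothesis on `h` covers the empty prefix, which `Completes` does not test. -/
theorem completes_iff (R : WalkStep r → WalkStep r → Prop) (d : Prop) (w : List (WalkStep r)) :
    ∀ (p : Option (WalkStep r)) (h : ℤ), (d → 0 ≤ h) → (Completes R d p h w ↔
      (p.toList ++ w).IsChain R ∧ h + walkEnd w (Fin.last r) = 0 ∧
        (d → ∀ u : List (WalkStep r), u <+: w → 0 ≤ h + walkEnd u (Fin.last r))) := by
  induction w with
  | nil =>
    intro p h hh
    cases p <;> simp [Completes, walkEnd_nil] <;> exact fun h0 _ => h0.ge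
  | cons v w ih =>
    intro p h hh
    have hpre : (∀ u : List (WalkStep r), u <+: v :: w → 0 ≤ h + walkEnd u (Fin.last r)) ↔
        0 ≤ h ∧ ∀ u : List (WalkStep r), u <+: w →
          0 ≤ h + v (Fin.last r) + walkEnd u (Fin.last r) := by
      constructor
      · intro H
        refine ⟨by simpa [walkEnd_nil] using H [] (List.nil_prefix), fun u hu => ?_⟩
        simpa [walkEnd_cons, add_assoc] using H (v :: u) (by simpa using hu)
      · rintro ⟨H0, H⟩ u hu
        rcases List.prefix_cons_iff.mp hu with rfl | ⟨t, rfl, ht⟩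
        · simpa [walkEnd_nil] using H0
        · simpa [walkEnd_cons, add_assoc] using H t ht
    have hchain : (p.toList ++ v :: w).IsChain R ↔
        (∀ u ∈ p, R u v) ∧ ((some v).toList ++ w).IsChain R := by
      cases p <;> simp
    rw [Completes, hchain, hpre, walkEnd_cons, ← add_assoc]
    constructor
    · rintro ⟨h1, h2, h3⟩
      obtain ⟨h4, h5, h6⟩ := (ih _ _ h2).mp h3
      exact ⟨⟨h1, h4⟩, h5, fun hd => ⟨hh hd, h6 hd⟩⟩
    · rintro ⟨⟨h1, h4⟩, h5, h6⟩
      have h2 : d → 0 ≤ h + v (Fin.last r) := fun hd => by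
        simpa [walkEnd_nil] using (h6 hd).2 [] List.nil_prefix
      exact ⟨h1, h2, (ih _ _ h2).mpr ⟨h4, h5, fun hd => (h6 hd).2⟩⟩

theorem mem_walkLang_iff (R : WalkStep r → WalkStep r → Prop) (d : Prop)
    (w : List (WalkStep r)) : w ∈ walkLang R d ↔ Completes R d none 0 w := by
  rw [completes_iff R d w none 0 fun _ => le_rfl]
  simp only [Option.toList_none, List.nil_append, zero_add]
  rfl

theorem isChain_not_iff {α : Type*} (f : α → α) (w : List α) :
    w.IsChain (fun v u => u ≠ f v) ↔ ∀ v, ¬ [v, f v] <:+: w := by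
  induction w with
  | nil => simp
  | cons x w ih =>
    simp only [List.infix_cons_iff, not_or, forall_and, ← ih, List.isChain_cons]
    refine and_congr_left fun _ => ?_
    cases w with
    | nil => simp
    | cons y w =>
      simp only [List.head?_cons, Option.mem_def, Option.some.injEq, forall_eq',
        List.cons_prefix_cons, List.nil_prefix, and_true]
      exact ⟨fun h v ⟨h1, h2⟩ => h (by rw [← h2, h1]), fun h h1 => h x ⟨rfl, h1.symm⟩⟩

end WalkLanguages

/-! ### The one-counter automaton -/

section PushdownAutomaton

variable {r : ℕ}

/-- A stack of height `n + 1`; a symbol is `true` if it is one of the lowest two. -/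
def counterStack : ℕ → List Bool
  | 0 => [true]
  | n + 1 => decide (n = 0) :: counterStack n

open Classical in
/-- The state holds the previous step and the sign of the height, the stack its absolute value. -/
noncomputable def walkDPDA (R : WalkStep r → WalkStep r → Prop) (d : Prop) :
    DPDA (WalkStep r) (Option (WalkStep r) × SignType) Bool where
  start := (none, 0)
  bottom := true
  accept := {q | q.2 = 0}
  step q o Z := o.bind fun v =>
    if ∀ u ∈ q.1, R u v then
      if q.2 = 0 then
        if d ∧ v (Fin.last r) = -1 then none
        else some ((some v, SignType.sign (v (Fin.last r) : ℤ)), [true, Z])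
      else if q.2 = SignType.sign (v (Fin.last r) : ℤ) then some ((some v, q.2), [false, Z])
      -- At nonzero height, a top symbol `true` is the second lowest one, so the absolute height is
      -- 1 and this pop reaches zero. The mark thus detects zero without ε-moves.
      else some ((some v, if Z then 0 else q.2), [])
    else none
  deterministic := by simp

theorem walkDPDA_move_cons_iff (R : WalkStep r → WalkStep r → Prop) (d : Prop)
    (q : Option (WalkStep r) × SignType) (v : WalkStep r) (w : List (WalkStep r)) (Z : Bool)
    (s : List Bool) (c : (Option (WalkStep r) × SignType) × List (WalkStep r) × List Bool) :
    (walkDPDA R d).Move (q, v :: w, Z :: s) c ↔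
      ∃ q' γ, (walkDPDA R d).step q (some v) Z = some (q', γ) ∧ c = (q', w, γ ++ s) := by
  constructor
  · intro hm
    cases hm with
    | read h => exact ⟨_, _, h, rfl⟩
    | eps h => simp [walkDPDA] at h
  · rintro ⟨q', γ, h, rfl⟩
    exact .read h

/-- The simulation invariant: configurations encode the previous step and the height, and exactly
the admissible letters can be read. -/
theorem walkDPDA_move_iff (R : WalkStep r → WalkStep r → Prop) (d : Prop)
    (p : Option (WalkStep r)) (h : ℤ) (hh : d → 0 ≤ h) (v : WalkStep r) (w : List (WalkStep r))
    (c : (Option (WalkStep r) × SignType) × List (WalkStep r) × List Bool) :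
    (walkDPDA R d).Move ((p, SignType.sign h), v :: w, counterStack h.natAbs) c ↔
      (∀ u ∈ p, R u v) ∧ (d → 0 ≤ h + v (Fin.last r)) ∧
        c = ((some v, SignType.sign (h + v (Fin.last r))), w,
          counterStack (h + v (Fin.last r)).natAbs) := by
  have hpos : ∀ n : ℕ, SignType.sign ((n : ℤ) + 1) = 1 := fun n => sign_pos (by positivity)
  have hneg : ∀ n : ℕ, SignType.sign (-((n : ℤ) + 1)) = -1 := fun n => sign_neg (by omega)
  obtain ⟨Z, s, hs⟩ : ∃ Z s, counterStack h.natAbs = Z :: s := by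
    cases h.natAbs <;> simp [counterStack]
  rw [hs, walkDPDA_move_cons_iff]
  by_cases hR : ∀ u ∈ p, R u v
  swap
  · simp only [walkDPDA, Option.bind_some, if_neg hR]
    simp only [hR, false_and, iff_false]
    simp
  simp only [walkDPDA, Option.bind_some, if_pos hR]
  rw [and_iff_right hR]
  rcases lt_trichotomy h 0 with h0 | rfl | h0
  · have hd : ¬ d := fun hd => absurd (hh hd) (by omega)
    obtain ⟨n, rfl⟩ : ∃ n : ℕ, h = -((n : ℤ) + 1) := ⟨(-h - 1).toNat, by omega⟩
    have hn : (-((n : ℤ) + 1)).natAbs = n + 1 := by omega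
    rw [hn, counterStack, List.cons.injEq] at hs
    obtain ⟨rfl, rfl⟩ := hs
    rcases Int.units_eq_one_or (v (Fin.last r)) with hv | hv
    · have e : -((n : ℤ) + 1) + ((1 : ℤˣ) : ℤ) = -n := by simp
      rw [hv, e, hneg]
      cases n with
      | zero => simp [hd, counterStack]
      | succ n =>
        have e' : ((n : ℤ) + 1).natAbs = n + 1 := by omega
        simp [hd, -neg_add_rev, hneg, e']
    · have e : -((n : ℤ) + 1) + ((-1 : ℤˣ) : ℤ) = -((n + 1 : ℕ) + 1) := by simp; ring
      have hn' : (-(((n + 1 : ℕ) : ℤ) + 1)).natAbs = n + 1 + 1 := by omega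
      rw [hv, e, hneg, hneg, hn']
      simp [hd, counterStack]
  · obtain ⟨rfl, rfl⟩ : true = Z ∧ [] = s := by simpa [counterStack] using hs
    rcases Int.units_eq_one_or (v (Fin.last r)) with hv | hv
    · simp [hv, counterStack]
    · by_cases hd : d <;> simp [hv, counterStack, hd]
  · obtain ⟨n, rfl⟩ : ∃ n : ℕ, h = (n : ℤ) + 1 := ⟨(h - 1).toNat, by omega⟩
    have hn : ((n : ℤ) + 1).natAbs = n + 1 := by omega
    rw [hn, counterStack, List.cons.injEq] at hs
    obtain ⟨rfl, rfl⟩ := hs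
    rcases Int.units_eq_one_or (v (Fin.last r)) with hv | hv
    · have e : (n : ℤ) + 1 + ((1 : ℤˣ) : ℤ) = (n + 1 : ℕ) + 1 := by simp
      have hn' : (((n + 1 : ℕ) : ℤ) + 1).natAbs = n + 1 + 1 := by omega
      rw [hv, e, hpos, hpos, hn']
      have hd : d → (0 : ℤ) ≤ (n + 1 : ℕ) + 1 := fun _ => by positivity
      rw [and_iff_right hd]
      simp [counterStack]
    · have e : (n : ℤ) + 1 + ((-1 : ℤˣ) : ℤ) = n := by simp
      rw [hv, e, hpos]
      cases n with
      | zero => simp [counterStack]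
      | succ n =>
        have e' : ((n : ℤ) + 1).natAbs = n + 1 := by omega
        have e'' : (0 : ℤ) ≤ n + 1 := by positivity
        simp [hpos, e', e'']

theorem walkDPDA_reaches_iff (R : WalkStep r → WalkStep r → Prop) (d : Prop)
    (w : List (WalkStep r)) : ∀ (p : Option (WalkStep r)) (h : ℤ), (d → 0 ≤ h) →
      ((∃ q ∈ (walkDPDA R d).accept, ∃ s : List Bool, Relation.ReflTransGen (walkDPDA R d).Move
        ((p, SignType.sign h), w, counterStack h.natAbs) (q, [], s)) ↔ Completes R d p h w) := by
  induction w with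
  | nil =>
    intro p h hh
    have hstep : ∀ (q : Option (WalkStep r) × SignType) (s : List Bool) c,
        ¬ (walkDPDA R d).Move (q, [], s) c := by
      rintro q s c hm
      cases hm with
      | eps h => simp [walkDPDA] at h
    constructor
    · rintro ⟨q, hq, s, hr⟩
      rcases hr.cases_head with heq | ⟨c, hc, _⟩
      · rw [Prod.mk.injEq] at heq
        rw [← heq.1] at hq
        simpa [walkDPDA, Completes] using hq
      · exact absurd hc (hstep _ _ _)
    · intro h0
      exact ⟨_, by simpa [walkDPDA, Completes] using h0, _, Relation.ReflTransGen.refl⟩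
  | cons v w ih =>
    intro p h hh
    constructor
    · rintro ⟨q, hq, s, hr⟩
      rcases hr.cases_head with heq | ⟨c, hc, hr⟩
      · simp at heq
      · obtain ⟨h1, h2, rfl⟩ := (walkDPDA_move_iff R d p h hh v w c).mp hc
        exact ⟨h1, h2, (ih _ _ h2).mp ⟨q, hq, s, hr⟩⟩
    · rintro ⟨h1, h2, h3⟩
      obtain ⟨q, hq, s, hr⟩ := (ih _ _ h2).mpr h3
      exact ⟨q, hq, s, hr.head ((walkDPDA_move_iff R d p h hh v w _).mpr ⟨h1, h2, rfl⟩)⟩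

theorem isDeterministicContextFree_walkLang (R : WalkStep r → WalkStep r → Prop) (d : Prop) :
    IsDeterministicContextFree (walkLang R d) := by
  refine ⟨Option (WalkStep r) × SignType, Bool, inferInstance, inferInstance, walkDPDA R d, ?_⟩
  ext w
  rw [mem_walkLang_iff, ← walkDPDA_reaches_iff R d w none 0 fun _ => le_rfl]
  simp only [sign_zero, Int.natAbs_zero]
  rfl

end PushdownAutomaton

/-! ### Reduction to weighted one-dimensional paths -/

section WordCount

variable {r : ℕ}

open Classical in
/-- The words of length `n` with `Completes R d p h`. -/
noncomputable def completions (R : WalkStep r → WalkStep r → Prop) (d : Prop) :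
    ℕ → Option (WalkStep r) → ℤ → Finset (List (WalkStep r))
  | 0, _, h => if h = 0 then {[]} else ∅
  | n + 1, p, h => Finset.univ.biUnion fun u =>
      if (∀ v ∈ p, R v u) ∧ (d → 0 ≤ h + u (Fin.last r)) then
        (completions R d n (some u) (h + u (Fin.last r))).image (List.cons u)
      else ∅

open Classical in
theorem mem_completions (R : WalkStep r → WalkStep r → Prop) (d : Prop) (n : ℕ) :
    ∀ (p : Option (WalkStep r)) (h : ℤ) (w : List (WalkStep r)),
      w ∈ completions R d n p h ↔ Completes R d p h w ∧ w.length = n := by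
  induction n with
  | zero =>
    intro p h w
    cases w <;> by_cases h0 : h = 0 <;> simp [completions, Completes, h0]
  | succ n ih =>
    intro p h w
    have key : ∀ u : WalkStep r, w ∈ (if (∀ v ∈ p, R v u) ∧ (d → 0 ≤ h + u (Fin.last r)) then
        (completions R d n (some u) (h + u (Fin.last r))).image (List.cons u) else ∅) ↔
        ((∀ v ∈ p, R v u) ∧ (d → 0 ≤ h + u (Fin.last r))) ∧
          ∃ t ∈ completions R d n (some u) (h + u (Fin.last r)), u :: t = w := fun u => by
      split_ifs with hu
      · rw [Finset.mem_image]
        tauto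
      · simp only [Finset.notMem_empty, false_iff]
        tauto
    rw [completions, Finset.mem_biUnion]
    simp only [Finset.mem_univ, true_and, key, ih]
    cases w with
    | nil => simp
    | cons v w =>
      simp only [List.cons.injEq, Completes, List.length_cons, Nat.add_right_cancel_iff]
      constructor
      · rintro ⟨u, ⟨h1, h2⟩, t, ⟨h3, h4⟩, rfl, rfl⟩
        exact ⟨⟨h1, h2, h3⟩, h4⟩
      · rintro ⟨⟨h1, h2, h3⟩, h4⟩
        exact ⟨v, ⟨h1, h2⟩, w, ⟨h3, h4⟩, rfl, rfl⟩

open Classical in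
theorem card_completions_succ (R : WalkStep r → WalkStep r → Prop) (d : Prop) (n : ℕ)
    (p : Option (WalkStep r)) (h : ℤ) : (completions R d (n + 1) p h).card =
      ∑ u : WalkStep r, if (∀ v ∈ p, R v u) ∧ (d → 0 ≤ h + u (Fin.last r)) then
        (completions R d n (some u) (h + u (Fin.last r))).card else 0 := by
  rw [completions, Finset.card_biUnion]
  · refine Finset.sum_congr rfl fun u _ => ?_
    split_ifs
    · exact Finset.card_image_of_injective _ List.cons_injective
    · rfl
  · intro u _ v _ huv
    rw [Function.onFun, Finset.disjoint_left]
    intro w hu hv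
    split_ifs at hu hv <;> simp only [Finset.mem_image, Finset.notMem_empty] at hu hv
    obtain ⟨_, _, rfl⟩ := hu
    obtain ⟨_, _, h2⟩ := hv
    exact huv (List.cons.inj h2).1.symm

theorem walkCount_walkLang (R : WalkStep r → WalkStep r → Prop) (d : Prop) (n : ℕ) :
    walkCount (walkLang R d) n = (completions R d (2 * n) none 0).card := by
  rw [walkCount, ← Set.ncard_coe_finset]
  congr 1
  ext w
  rw [Set.mem_ofPred_eq, mem_walkLang_iff, Finset.mem_coe, mem_completions]

theorem sum_ite_last (P : WalkStep r → Prop) (Q : ℤˣ → Prop) [DecidablePred Q]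
    [∀ u : WalkStep r, Decidable (P u ∧ Q (u (Fin.last r)))] (F : ℤˣ → ℚ) :
    (∑ u : WalkStep r, if P u ∧ Q (u (Fin.last r)) then F (u (Fin.last r)) else 0) =
      ∑ σ : ℤˣ, if Q σ then
        ({u : WalkStep r | u (Fin.last r) = σ ∧ P u}.ncard : ℚ) * F σ else 0 := by
  classical
  rw [← Finset.sum_fiberwise (s := Finset.univ) (g := fun u : WalkStep r => u (Fin.last r))]
  refine Finset.sum_congr rfl fun σ _ => ?_
  by_cases hQ : Q σ
  · rw [if_pos hQ, Set.ncard_eq_toFinset_card', Set.toFinset_ofPred, ← Finset.filter_filter,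
      Finset.card_filter, Nat.cast_sum, Finset.sum_mul]
    refine Finset.sum_congr rfl fun u hu => ?_
    have hu' := (Finset.mem_filter.mp hu).2
    by_cases hP : P u <;> simp [hP, hQ, hu']
  · rw [if_neg hQ]
    refine Finset.sum_eq_zero fun u hu => ?_
    have hu' := (Finset.mem_filter.mp hu).2
    simp [hQ, hu']

open Classical in
/-- The weighted number of `±1` walks of length `n` from height `h` to `0` (nonnegative ones if `d`
holds); a step has weight `a` if it repeats the previous one, `s` at the start, and else `b`. -/
noncomputable def pathCount (a b : ℚ) (d : Prop) : ℕ → ℤˣ → ℤ → ℚ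
  | 0, _, h => if h = 0 then 1 else 0
  | n + 1, s, h => ∑ u : ℤˣ, if d → 0 ≤ h + u then
      (if u = s then a else b) * pathCount a b d n u (h + u) else 0

-- Grouping the next letters by last coordinate leaves only the two weights `a` and `b`, by `hab`;
-- the other coordinates no longer matter.
open Classical in
theorem card_completions_some (R : WalkStep r → WalkStep r → Prop) (d : Prop) {a b : ℕ}
    (hab : ∀ (v : WalkStep r) (σ : ℤˣ),
      {u : WalkStep r | u (Fin.last r) = σ ∧ R v u}.ncard = if σ = v (Fin.last r) then a else b)
    (n : ℕ) : ∀ (v : WalkStep r) (h : ℤ),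
      ((completions R d n (some v) h).card : ℚ) = pathCount a b d n (v (Fin.last r)) h := by
  induction n with
  | zero =>
    intro v h
    by_cases h0 : h = 0 <;> simp [completions, pathCount, h0]
  | succ n ih =>
    intro v h
    rw [card_completions_succ, pathCount, Nat.cast_sum]
    simp only [Nat.cast_ite, ih, Nat.cast_zero, Option.mem_def, Option.some.injEq, forall_eq']
    rw [sum_ite_last (R v) (fun σ => d → 0 ≤ h + σ) (fun σ => pathCount a b d n σ (h + σ))]
    simp only [hab, Nat.cast_ite]

open Classical in
theorem walkCount_succ (R : WalkStep r → WalkStep r → Prop) (d : Prop) {a b K : ℕ}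
    (hab : ∀ (v : WalkStep r) (σ : ℤˣ),
      {u : WalkStep r | u (Fin.last r) = σ ∧ R v u}.ncard = if σ = v (Fin.last r) then a else b)
    (hK : ∀ σ : ℤˣ, {u : WalkStep r | u (Fin.last r) = σ}.ncard = K)
    (n : ℕ) : (walkCount (walkLang R d) (n + 1) : ℚ) =
      ∑ σ : ℤˣ, if d → 0 ≤ (σ : ℤ) then (K : ℚ) * pathCount a b d (2 * n + 1) σ σ else 0 := by
  rw [walkCount_walkLang, mul_add, mul_one, card_completions_succ, Nat.cast_sum]
  simp only [Nat.cast_ite, card_completions_some R d hab, Nat.cast_zero, zero_add]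
  rw [sum_ite_last (fun u => ∀ v ∈ none, R v u) (fun σ => d → 0 ≤ (σ : ℤ))
    (fun σ => pathCount a b d (2 * n + 1) σ σ)]
  simp [hK]

theorem sum_intUnits (f : ℤˣ → ℚ) : ∑ σ : ℤˣ, f σ = f 1 + f (-1) := by
  rw [UnitsInt.univ]
  simp

/-! ### Solving the path recursion by power series -/

variable (a b : ℚ) (d : Prop)

theorem pathCount_eq_zero (n : ℕ) : ∀ (s : ℤˣ) (h : ℤ), n < h → pathCount a b d n s h = 0 := by
  induction n with
  | zero =>
    intro s h hn
    have : h ≠ 0 := by omega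
    simp [pathCount, this]
  | succ n ih =>
    intro s h hn
    push_cast at hn
    rw [pathCount, sum_intUnits, ih 1 _ (by simp; omega), ih (-1) _ (by simp; omega)]
    simp

theorem pathCount_neg (hd : ¬ d) (n : ℕ) : ∀ (s : ℤˣ) (h : ℤ),
    pathCount a b d n (-s) (-h) = pathCount a b d n s h := by
  induction n with
  | zero => simp [pathCount]
  | succ n ih =>
    intro s h
    have e1 : -h + ((1 : ℤˣ) : ℤ) = -(h + ((-1 : ℤˣ) : ℤ)) := by simp; ring
    have e2 : -h + ((-1 : ℤˣ) : ℤ) = -(h + ((1 : ℤˣ) : ℤ)) := by simp; ring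
    have i1 := ih (-1) (h + ((-1 : ℤˣ) : ℤ))
    have i2 := ih 1 (h + ((1 : ℤˣ) : ℤ))
    rw [neg_neg] at i1
    rw [pathCount, pathCount, sum_intUnits, sum_intUnits]
    have hp : ∀ x : ℤ, d → 0 ≤ x := fun x h => absurd h hd
    rw [if_pos (hp _), if_pos (hp _), if_pos (hp _), if_pos (hp _), e1, e2, i1, i2, add_comm]
    rcases Int.units_eq_one_or s with rfl | rfl <;> simp

open PowerSeries in
open Classical in
/-- Walks ending at `0` from height `k + 1` after an up step, and from height `k` after a down
step, are counted by the solution of the linear system obtained by removing one step. -/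
theorem pathCount_eq_coeff {A B : ℕ → ℚ⟦X⟧} (hA : ∀ k, A k = X * (C a * A (k + 1)) + C b * B k)
    (hB : ∀ k, B (k + 1) = X * (C b * A (k + 1)) + C a * B k)
    (hB0 : B 0 = 1 + X * (C (if d then b else a + b) * A 0)) (N : ℕ) :
    (∀ k m : ℕ, k + 1 + 2 * m = N → pathCount a b d N 1 (k + 1) = coeff m (A k)) ∧
    (∀ k m : ℕ, k + 2 * m = N → pathCount a b d N (-1) k = coeff m (B k)) := by
  induction N with
  | zero =>
    refine ⟨fun k m h => by omega, fun k m h => ?_⟩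
    obtain ⟨rfl, rfl⟩ : k = 0 ∧ m = 0 := by omega
    simp [pathCount, hB0]
  | succ N ih =>
    obtain ⟨ihA, ihB⟩ := ih
    -- `m` counts the remaining steps away from zero, so such a step costs a factor `X`. For `m = 0`
    -- too few steps are left to return.
    have up : ∀ (k m : ℕ) (c : ℚ), k + 1 + 2 * m = N + 1 →
        c * pathCount a b d N 1 ((k : ℤ) + 1 + 1) = coeff m (X * (C c * A (k + 1))) := by
      intro k m c h
      cases m with
      | zero => rw [pathCount_eq_zero _ _ _ _ _ _ (by omega)]; simp
      | succ m =>
        rw [coeff_succ_X_mul, coeff_C_mul, ← ihA (k + 1) m (by omega)]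
        push_cast
        rfl
    have cond_up : ∀ k : ℕ, d → (0 : ℤ) ≤ k + ((1 : ℤˣ) : ℤ) := fun k _ => by
      rw [Units.val_one]; positivity
    have cond_down : ∀ k : ℕ, d → (0 : ℤ) ≤ (k + 1 : ℕ) + ((-1 : ℤˣ) : ℤ) := fun k _ => by simp
    refine ⟨fun k m h => ?_, fun k m h => ?_⟩
    · rw [pathCount, sum_intUnits, hA k, map_add, ← up k m a h, coeff_C_mul,
        ← ihB k m (by omega), ← Nat.cast_succ, if_pos (cond_up _), if_pos (cond_down _)]
      simp
    · cases k with
      | succ k =>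
        rw [pathCount, sum_intUnits, hB k, map_add, ← up k m b h, coeff_C_mul,
          ← ihB k m (by omega), if_pos (cond_up _), if_pos (cond_down _)]
        simp
      | zero =>
        obtain ⟨m, rfl⟩ : ∃ m', m = m' + 1 := ⟨m - 1, by omega⟩
        rw [pathCount, sum_intUnits, hB0, map_add, coeff_succ_X_mul, coeff_C_mul,
          ← ihA 0 m (by omega), if_pos (cond_up _)]
        by_cases hd : d
        · have hneg : ¬ (d → (0 : ℤ) ≤ (0 : ℕ) + ((-1 : ℤˣ) : ℤ)) := fun h => by simpa using h hd
          rw [if_neg hneg, if_pos hd]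
          simp [coeff_one]
        -- A down step from 0 repeats the previous one, with weight `a`; by reflection it continues
        -- like an up step, whence `a + b`.
        · rw [if_pos (absurd · hd), if_neg hd]
          have := pathCount_neg a b d hd N 1 1
          simp [coeff_one, this]
          ring

-- Try `A k = α μ^k` and `B k = β μ^k`. The system becomes `α (1 - X a μ) = b β` and `β (μ - a) = X
-- b μ α`; eliminating `α` and `β` gives the quadratic for `μ`, and the boundary equation at height
-- 0 then fixes `α`.
open PowerSeries in
open Classical in
theorem exists_excursion_series : ∃ μ α : ℚ⟦X⟧,
    μ = C a + X * (C a * μ ^ 2 + C (b ^ 2 - a ^ 2) * μ) ∧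
    α * (1 - X * C a * μ - X * C b * C (if d then b else a + b)) = C b ∧
    ∀ m, pathCount a b d (2 * m + 1) 1 1 = coeff m α := by
  set e := if d then b else a + b with he
  obtain ⟨μ, hμ⟩ := exists_slope a (b ^ 2 - a ^ 2)
  have h0 : constantCoeff (1 - X * C a * μ - X * C b * C e) ≠ 0 := by simp
  have h1 : (1 : ℚ⟦X⟧) - X * C a * μ ≠ 0 := fun h => by
    simpa using congrArg constantCoeff h
  set α := C b * (1 - X * C a * μ - X * C b * C e)⁻¹ with hαdef
  have hα : α * (1 - X * C a * μ - X * C b * C e) = C b := by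
    rw [hαdef, mul_assoc, PowerSeries.inv_mul_cancel _ h0, mul_one]
  refine ⟨μ, α, hμ, hα, fun m => ?_⟩
  set β := 1 + X * (C e * α) with hβ
  have hαβ : α = X * (C a * (α * μ)) + C b * β := by
    rw [hβ]
    linear_combination hα
  have hβμ : β * μ = X * (C b * (α * μ)) + C a * β := by
    apply mul_left_cancel₀ h1
    simp only [map_sub, map_pow] at hμ
    linear_combination β * hμ - X * C b * μ * hαβ
  have := (pathCount_eq_coeff a b d (A := fun k => α * μ ^ k) (B := fun k => β * μ ^ k)
    (fun k => by linear_combination μ ^ k * hαβ) (fun k => by linear_combination μ ^ k * hβμ)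
    (by simp [hβ, he]) (2 * m + 1)).1 0 m (by omega)
  simpa using this

end WordCount

/-! ### The generating function and the six languages -/

section Main

variable {r : ℕ}

open Classical in
theorem walkLang_properties (R : WalkStep r → WalkStep r → Prop) (d : Prop) {a b K : ℕ}
    (hab : ∀ (v : WalkStep r) (σ : ℤˣ),
      {u : WalkStep r | u (Fin.last r) = σ ∧ R v u}.ncard = if σ = v (Fin.last r) then a else b)
    (hK : ∀ σ : ℤˣ, {u : WalkStep r | u (Fin.last r) = σ}.ncard = K) :
    IsDeterministicContextFree (walkLang R d) ∧
      IsAlgebraic (Polynomial ℚ) (walkGenFun (walkLang R d)) ∧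
      IsHolonomic (fun n => (walkCount (walkLang R d) n : ℚ)) := by
  refine ⟨isDeterministicContextFree_walkLang R d, ?_⟩
  obtain ⟨μ, α, hμ, hα, hcoeff⟩ := exists_excursion_series a b d
  -- A nonempty walk starts with one of `K` up letters or, without the constraint, one of `K` down
  -- letters, which contribute equally by reflection.
  have hG : walkGenFun (walkLang R d) =
      1 + PowerSeries.X * PowerSeries.C ((if d then 1 else 2 : ℚ) * K) * α := by
    ext n
    rw [walkGenFun, PowerSeries.coeff_mk]
    cases n with
    | zero =>
      rw [walkCount_walkLang]
      simp [completions]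
    | succ n =>
      rw [walkCount_succ R d hab hK, sum_intUnits, map_add, mul_assoc,
        PowerSeries.coeff_succ_X_mul, PowerSeries.coeff_C_mul, ← hcoeff]
      by_cases hd : d
      · have hneg : ¬ (d → (0 : ℤ) ≤ ((-1 : ℤˣ) : ℤ)) := fun h => by simpa using h hd
        rw [if_pos (by simp), if_neg hneg, if_pos hd]
        simp [PowerSeries.coeff_one]
      · rw [if_pos (absurd · hd), if_pos (absurd · hd), if_neg hd]
        have := pathCount_neg a b d hd (2 * n + 1) 1 1
        simp [PowerSeries.coeff_one, this]
        ring
  obtain ⟨S, Δ, d', p, q, hS, hΔ, hd', hq⟩ :=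
    exists_quadratic_form a b _ ((if d then 1 else 2 : ℚ) * K) hμ hα
  rw [← hG] at hq
  exact ⟨isAlgebraic_of_quadratic hS hd' hq, isHolonomic_of_quadratic hS hΔ hd' hq⟩

theorem card_last_eq (σ : ℤˣ) :
    {u : WalkStep r | u (Fin.last r) = σ}.ncard =
      {u : WalkStep r | u (Fin.last r) = 1}.ncard := by
  rcases Int.units_eq_one_or σ with rfl | rfl
  · rfl
  · refine Set.ncard_congr' ((Equiv.neg (WalkStep r)).subtypeEquiv fun u => ?_)
    simp [neg_eq_iff_eq_neg]

theorem card_last_eq_and_ne (z : WalkStep r) (σ : ℤˣ) :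
    {u : WalkStep r | u (Fin.last r) = σ ∧ u ≠ z}.ncard =
      if σ = z (Fin.last r) then
        {u : WalkStep r | u (Fin.last r) = 1}.ncard - 1
      else {u : WalkStep r | u (Fin.last r) = 1}.ncard := by
  have hdiff : {u : WalkStep r | u (Fin.last r) = σ ∧ u ≠ z} =
      {u : WalkStep r | u (Fin.last r) = σ} \ {z} := rfl
  rw [← card_last_eq σ, hdiff]
  split_ifs with h
  · exact Set.ncard_sdiff_singleton_of_mem h.symm
  · rw [Set.sdiff_singleton_eq_self (show z ∉ {u : WalkStep r | u (Fin.last r) = σ} from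
      fun h' => h (Eq.symm h'))]

theorem walkLang_true (d : Prop) : walkLang (fun _ _ : WalkStep r => True) d =
    {w : List (WalkStep r) | walkEnd w (Fin.last r) = 0 ∧
      (d → ∀ u : List (WalkStep r), u <+: w → 0 ≤ walkEnd u (Fin.last r))} := by
  ext w
  have : w.IsChain fun _ _ : WalkStep r => True := List.isChain_iff_getElem.mpr (by simp)
  exact ⟨fun h => h.2, fun h => ⟨this, h⟩⟩

theorem walkLang_ne (f : WalkStep r → WalkStep r) (d : Prop) :
    walkLang (fun v u => u ≠ f v) d = walkLang (fun _ _ : WalkStep r => True) d ⊓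
      {w : List (WalkStep r) | ∀ v : WalkStep r, ¬ [v, f v] <:+: w} := by
  rw [walkLang_true]
  ext w
  exact (and_congr_left fun _ => isChain_not_iff f w).trans and_comm

theorem walkLang_true_false : walkLang (fun _ _ : WalkStep r => True) False = walkA r := by
  rw [walkLang_true]
  simp only [false_imp_iff, and_true]
  rfl

theorem walkLang_true_true : walkLang (fun _ _ : WalkStep r => True) True = walkD r := by
  rw [walkLang_true]
  simp only [true_imp_iff]
  rfl

end Main

theorem mainTheorem7 (r : ℕ) (L : Language (WalkStep r))
    (hL : L ∈ ({walkA r, walkB r, walkC r, walkD r, walkE r, walkF r} :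
      Set (Language (WalkStep r)))) :
    IsDeterministicContextFree L ∧
      IsAlgebraic (Polynomial ℚ) (walkGenFun L) ∧
      IsHolonomic (fun n => (walkCount L n : ℚ)) := by
  set K := {u : WalkStep r | u (Fin.last r) = 1}.ncard
  have free := fun d => walkLang_properties (r := r) (fun _ _ => True) d (a := K) (b := K)
    (fun v σ => by simpa using card_last_eq σ) card_last_eq
  -- The forbidden letter `-v` has the opposite last coordinate, so `b` drops by one; forbidding `v`
  -- itself lowers `a` instead.
  have noBack := fun d => walkLang_properties (r := r) (fun v u => u ≠ -v) d (a := K) (b := K - 1)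
    (fun v σ => by
      rw [card_last_eq_and_ne]
      rcases Int.units_eq_one_or σ with rfl | rfl <;>
      rcases Int.units_eq_one_or (v (Fin.last r)) with hv | hv <;> simp [hv, K]) card_last_eq
  have noRepeat := fun d => walkLang_properties (r := r) (fun v u => u ≠ v) d (a := K - 1) (b := K)
    (fun v σ => card_last_eq_and_ne v σ) card_last_eq
  rcases hL with rfl | rfl | rfl | rfl | rfl | rfl
  · rw [← walkLang_true_false]; exact free False
  · rw [walkB, ← walkLang_true_false, walkX, ← walkLang_ne]; exact noBack False
  · rw [walkC, ← walkLang_true_false, walkY, ← walkLang_ne]; exact noRepeat False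
  · rw [← walkLang_true_true]; exact free True
  · rw [walkE, ← walkLang_true_true, walkX, ← walkLang_ne]; exact noBack True
  · rw [walkF, ← walkLang_true_true, walkY, ← walkLang_ne]; exact noRepeat True
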